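/- Let $\lambda$ and $\mu$ be strict partitions (partitions with distinct positive parts, indexed decreasingly and padded with zeros) with $\mu_i\le\lambda_i$ for all $i$, and let $S(\lambda)$ be the shifted diagram of $\lambda$, whose squares are the $(i,j)$ with $i\le j\le i+\lambda_i-1$. Put $S(\lambda/\mu)=S(\lambda)\setminus S(\mu)$ and $|\lambda/\mu|=|S(\lambda/\mu)|$. A *strip* is a nonempty, rookwise connected $S(\lambda/\mu)$ with at most one square on each diagonal $\{j-i=d\}$; if it occupies $h$ rows, its weight is $(-1)^{h-1}$. A *double strip* is an $S(\lambda/\mu)$ that is the disjoint union of two strips $S(\lambda/\nu)$ and $S(\nu/\mu)$, with $\nu$ a strict partition, each containing a square $(j,j)$; its weight is $2(-1)^{\alpha+\beta-1}$, where $\alpha$ is its number of diagonals of length two and $\beta$ is the number of rows occupied by its diagonals of length one. A *strip tableau* of shape $\lambda/\mu$ and type $\pi=(\pi_1,\dots,\pi_k)$ is a chain of strict partitions $\mu=\lambda^0\subseteq\lambda^1\subseteq\cdots\subseteq\lambda^k=\lambda$ such that each $S(\lambda^i/\lambda^{i-1})$ is a strip or a double strip with $\pi_i$ squares; its weight $wt(T)$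 is the product of their weights. The *skew Schur $Q$-function* is $$Q_{\lambda/\mu}=\sum_{\pi}\sum_{T}2^{\ell(\pi)}\,wt(T)\,\frac{p_\pi}{z_\pi},$$ where $\pi$ runs over the partitions of $|\lambda/\mu|$ with only odd parts, $T$ over the strip tableaux of shape $\lambda/\mu$ and type $\pi$, $p_\pi=\prod_i p_{\pi_i}$ with $p_k=\sum_{i}x_i^k$ in infinitely many variables, and $z_\pi=\prod_i i^{m_i}m_i!$ if $\pi$ has $m_i$ parts equal to $i$. A *skew bar tableau* of shape $\lambda/\mu$ is a filling of $S(\lambda)$ with nonnegative integers such that (1) rows are weakly increasing; (2) every positive integer that occurs does so an odd number of times; (3) every positive integer occurs in at most two rows, and if it occurs in two rows then both begin with it; (4) for every $a\geq 0$, the nonzero row lengths that remain after removing all entries larger than $a$ are distinct; (5) the rows that remain after removing all positive entries are, up to order, those of $\mu$. Its number of bars is the number of distinct positive integers that occur in it, and $\mathrm{srank}(\lambda/\mu)$ is the least number of bars of a skew bar tableau of shape $\lambda/\mu$. Then every term of $Q_{\lambda/\mu}$ has degree at least $\mathrm{srank}(\lambda/\mu)$, where $\deg p_\nu=\ell(\nu)$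 is the number of parts of $\nu$. That is, $Q_{\lambda/\mu}$ has a unique expansion $\sum_\nu c_\nu p_\nu$ as a finite rational linear combination of power sums $p_\nu$ ($\nu$ ranging over all partitions), and $\ell(\nu)\ge\mathrm{srank}(\lambda/\mu)$ whenever $c_\nu\ne 0$. -/

import Mathlib

/-- A strict partition `λ₁ > λ₂ > ⋯ > λ_k > 0`, padded with zeros; `part i` is `λ_{i+1}`. -/
@[ext]
structure StrictPartition where
  part : ℕ → ℕ
  strict : ∀ i, part (i + 1) < part i ∨ part (i + 1) = 0

namespace StrictPartition

/-- Containment of diagrams: `μ_i ≤ λ_i` for all `i`. -/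
instance : LE StrictPartition := ⟨fun mu lam => ∀ i, mu.part i ≤ lam.part i⟩

theorem part_add_le (lam : StrictPartition) (i : ℕ) (h : lam.part i ≠ 0) :
    lam.part i + i ≤ lam.part 0 := by
  induction i with
  | zero => simp
  | succ k ih =>
    have h1 := lam.strict k
    have h2 := ih (by omega)
    omega

/-- The shifted diagram `S(λ)`: row `i` (counted from `0`) consists of the `λ_{i+1}` squares
`(i, j)` with `i ≤ j < i + λ_{i+1}`. -/
def shifted (lam : StrictPartition) : Finset (ℕ × ℕ) :=
  (Finset.range (lam.part 0) ×ˢ Finset.range (lam.part 0)).filter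
    (fun c => c.1 ≤ c.2 ∧ c.2 < c.1 + lam.part c.1)

theorem mem_shifted (lam : StrictPartition) (c : ℕ × ℕ) :
    c ∈ lam.shifted ↔ c.1 ≤ c.2 ∧ c.2 < c.1 + lam.part c.1 := by
  simp only [shifted, Finset.mem_filter, Finset.mem_product, Finset.mem_range,
    and_iff_right_iff_imp]
  rintro ⟨h1, h2⟩
  have := lam.part_add_le c.1 (by omega)
  omega

theorem finite_le (lam : StrictPartition) : Finite {mu : StrictPartition // mu ≤ lam} := by
  refine Finite.of_injective
    (fun mu (i : Fin (lam.part 0)) =>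
      (⟨mu.1.part i, Nat.lt_succ_of_le (mu.2 i |>.trans (by
        by_cases h : lam.part i = 0
        · omega
        · have := lam.part_add_le i h
          omega))⟩ : Fin (lam.part 0 + 1))) ?_
  intro mu nu h
  ext i
  by_cases hi : i < lam.part 0
  · simpa using congrFun h ⟨i, hi⟩
  · have h0 : lam.part i = 0 := by
      by_contra h'
      have := lam.part_add_le i h'
      omega
    have h1 := mu.2 i
    have h2 := nu.2 i
    omega

end StrictPartition

/-- The skew shifted diagram `S(λ/μ) = S(λ) \ S(μ)`. -/
def skewShifted (lam mu : StrictPartition) : Finset (ℕ × ℕ) := lam.shifted \ mu.shifted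

/-! ### Strips, double strips and strip tableaux -/

/-- Two squares share an edge. -/
def RookAdj (a b : ℕ × ℕ) : Prop :=
  (a.1 = b.1 ∧ (a.2 = b.2 + 1 ∨ b.2 = a.2 + 1)) ∨ (a.2 = b.2 ∧ (a.1 = b.1 + 1 ∨ b.1 = a.1 + 1))

/-- A nonempty set of squares any two of which are joined by a path of edge-adjacent squares. -/
def RookConnected (D : Finset (ℕ × ℕ)) : Prop :=
  D.Nonempty ∧ ∀ a ∈ D, ∀ b ∈ D, Relation.ReflTransGen (fun x y => y ∈ D ∧ RookAdj x y) a b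

/-- The squares of `D` on the diagonal `(0, d), (1, d + 1), (2, d + 2), …`. -/
def diagonal (D : Finset (ℕ × ℕ)) (d : ℕ) : Finset (ℕ × ℕ) := D.filter (fun c => c.2 = c.1 + d)

/-- `S(λ/μ)` is a strip. -/
def IsStrip (lam mu : StrictPartition) : Prop :=
  RookConnected (skewShifted lam mu) ∧ ∀ d, (diagonal (skewShifted lam mu) d).card ≤ 1

/-- `S(λ/μ)` is a double strip: it is the (disjoint) union of two strips `S(λ/ν)` and `S(ν/μ)`,
both of which start on the diagonal of the squares `(j, j)`. -/
def IsDoubleStrip (lam mu : StrictPartition) : Prop :=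
  ∃ nu : StrictPartition, mu ≤ nu ∧ nu ≤ lam ∧ IsStrip lam nu ∧ IsStrip nu mu ∧
    (diagonal (skewShifted lam nu) 0).Nonempty ∧ (diagonal (skewShifted nu mu) 0).Nonempty

/-- The number of rows that a strip occupies. -/
def height (D : Finset (ℕ × ℕ)) : ℕ := (D.image Prod.fst).card

/-- The depth `α + β` of a double strip: `α` is the number of diagonals of length two, and the
diagonals of length one occupy `β` rows. -/
def depth (D : Finset (ℕ × ℕ)) : ℕ :=
  ((D.image (fun c => c.2 - c.1)).filter (fun d => (diagonal D d).card = 2)).card +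
    ((D.filter (fun c => (diagonal D (c.2 - c.1)).card = 1)).image Prod.fst).card

open Classical in
/-- The weight of a strip of height `h` is `(-1)^(h-1)`, that of a double strip of depth `d`
is `2(-1)^(d-1)`. (A shape that is neither never occurs in a strip tableau.) -/
noncomputable def stepWeight (lam mu : StrictPartition) : ℚ :=
  if IsStrip lam mu then (-1) ^ (height (skewShifted lam mu) - 1)
  else if IsDoubleStrip lam mu then 2 * (-1) ^ (depth (skewShifted lam mu) - 1)
  else 0

/-- A strip tableau of shape `λ/μ` and type `π = (π₁, …, π_k)`. -/
@[ext]
structure StripTableau (lam mu : StrictPartition) (pi : List ℕ) where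
  shape : Fin (pi.length + 1) → StrictPartition
  first : shape 0 = mu
  last : shape (Fin.last pi.length) = lam
  mono : ∀ i : Fin pi.length, shape i.castSucc ≤ shape i.succ
  size : ∀ i : Fin pi.length, (skewShifted (shape i.succ) (shape i.castSucc)).card = pi.get i
  step : ∀ i : Fin pi.length, IsStrip (shape i.succ) (shape i.castSucc) ∨
    IsDoubleStrip (shape i.succ) (shape i.castSucc)

/-- There are finitely many strip tableaux of given shape and type. -/
instance (lam mu : StrictPartition) (pi : List ℕ) : Finite (StripTableau lam mu pi) := by
  have key : ∀ (T : StripTableau lam mu pi) (i : Fin (pi.length + 1)), T.shape i ≤ lam := by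
    intro T i
    induction i using Fin.reverseInduction with
    | last => rw [T.last]; exact fun _ => le_rfl
    | cast j ih => exact fun n => (T.mono j n).trans (ih n)
  have := lam.finite_le
  refine Finite.of_injective
    (fun T (i : Fin (pi.length + 1)) => (⟨T.shape i, key T i⟩ : {mu // mu ≤ lam})) ?_
  intro T U h
  ext i : 2
  exact congrArg Subtype.val (congrFun h i)

/-- The weight of a strip tableau: the product of the weights of its strips and double strips. -/
noncomputable def StripTableau.weight {lam mu : StrictPartition} {pi : List ℕ}
    (T : StripTableau lam mu pi) : ℚ :=
  ∏ i : Fin pi.length, stepWeight (T.shape i.succ) (T.shape i.castSucc)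

/-! ### Power sums and the skew Schur `Q`-function -/

open Classical in
/-- The power sum `p_k = ∑_i x_i^k` (for `k ≥ 1`), as a formal power series in the variables
`x_0, x_1, x_2, …`: its coefficient is `1` at the monomials `x_i^k` and `0` elsewhere. -/
noncomputable def powerSum (k : ℕ) : MvPowerSeries ℕ ℚ :=
  fun m => if ∃ i : ℕ, m = Finsupp.single i k then 1 else 0

/-- `p_π = p_{π₁} p_{π₂} ⋯`. -/
noncomputable def powerSumPartition {n : ℕ} (pi : n.Partition) : MvPowerSeries ℕ ℚ :=
  (pi.parts.map powerSum).prod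

/-- `z_π = 1^{m₁} m₁! 2^{m₂} m₂! ⋯`, where `m_i` is the number of parts of `π` equal to `i`. -/
def zee {n : ℕ} (pi : n.Partition) : ℕ :=
  ∏ i ∈ pi.parts.toFinset, i ^ pi.parts.count i * (pi.parts.count i).factorial

/-- The skew Schur `Q`-function
`Q_{λ/μ} = ∑_π ∑_T 2^{ℓ(π)} wt(T) p_π / z_π`, where `π` runs over the partitions of `|λ/μ|` with
only odd parts and `T` over the strip tableaux of shape `λ/μ` and type `π` (the parts of `π` being
listed in weakly decreasing order). -/
noncomputable def skewQ (lam mu : StrictPartition) : MvPowerSeries ℕ ℚ :=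
  ∑ pi ∈ Nat.Partition.odds (skewShifted lam mu).card,
    ∑ᶠ T : StripTableau lam mu (pi.parts.sort (· ≥ ·)),
      ((2 : ℚ) ^ pi.parts.card * T.weight / (zee pi : ℚ)) • powerSumPartition pi

/-- `f = ∑_π c_π p_π`, a finite sum over partitions `π` of arbitrary natural numbers. -/
def IsPowerSumExpansion (f : MvPowerSeries ℕ ℚ) (c : (Σ n : ℕ, n.Partition) →₀ ℚ) : Prop :=
  f = c.sum (fun pi a => a • powerSumPartition pi.2)

/-! ### Skew bar tableaux and the srank -/

/-- The number of squares in row `i` of `S(λ)` whose entry is at most `a`. -/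
def rowLength (lam : StrictPartition) (entry : ℕ × ℕ → ℕ) (a i : ℕ) : ℕ :=
  (lam.shifted.filter (fun c => c.1 = i ∧ entry c ≤ a)).card

/-- A skew bar tableau of shape `λ/μ`: a filling of the squares of `S(λ)` with nonnegative
integers (`entry` is set to `0` off `S(λ)`) such that
(1) every row is weakly increasing;
(2) every positive integer that appears does so an odd number of times;
(3) a positive integer appears in at most two rows, and if it appears in two rows, then both rows
begin with it;
(4) for every `a`, the nonzero row lengths left after the squares with entries larger than `a`
have been removed are distinct;
(5) when all squares with positive entries are removed, the remaining rows are, after reordering,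
those of `μ`. -/
structure SkewBarTableau (lam mu : StrictPartition) where
  entry : ℕ × ℕ → ℕ
  entry_off : ∀ c, c ∉ lam.shifted → entry c = 0
  row_weak : ∀ i j k, (i, j) ∈ lam.shifted → (i, k) ∈ lam.shifted → j ≤ k →
    entry (i, j) ≤ entry (i, k)
  odd_count : ∀ a, 0 < a → (∃ c ∈ lam.shifted, entry c = a) →
    Odd (lam.shifted.filter (fun c => entry c = a)).card
  two_rows : ∀ a, 0 < a →
    ((lam.shifted.filter (fun c => entry c = a)).image Prod.fst).card ≤ 2
  begins : ∀ a, 0 < a → ∀ c ∈ lam.shifted, ∀ d ∈ lam.shifted, entry c = a → entry d = a →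
    c.1 ≠ d.1 → entry (c.1, c.1) = a ∧ entry (d.1, d.1) = a
  distinct : ∀ a i j, i ≠ j → rowLength lam entry a i = rowLength lam entry a j →
    rowLength lam entry a i = 0
  inner : ∃ s : Equiv.Perm ℕ, ∀ i, rowLength lam entry 0 (s i) = mu.part i

theorem StrictPartition.part_lt (lam : StrictPartition) {i j : ℕ} (h : i < j)
    (hj : lam.part j ≠ 0) : lam.part j < lam.part i := by
  induction j, h using Nat.le_induction with
  | base =>
    have := lam.strict i
    simp only [Nat.succ_eq_add_one] at hj ⊢
    omega
  | succ k hk ih =>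
    have h1 := lam.strict k
    have h2 := ih (by omega)
    omega

theorem rowLength_eq (lam : StrictPartition) (entry : ℕ × ℕ → ℕ) (a i m : ℕ)
    (hm : m ≤ lam.part i)
    (h : ∀ t, t < lam.part i → (entry (i, i + t) ≤ a ↔ t < m)) :
    rowLength lam entry a i = m := by
  have : lam.shifted.filter (fun c => c.1 = i ∧ entry c ≤ a)
      = (Finset.range m).image (fun t => (i, i + t)) := by
    ext ⟨x, y⟩
    simp only [Finset.mem_filter, StrictPartition.mem_shifted, Finset.mem_image, Finset.mem_range,
      Prod.mk.injEq]
    constructor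
    · rintro ⟨⟨h1, h2⟩, rfl, h3⟩
      obtain ⟨t, rfl⟩ := Nat.exists_eq_add_of_le h1
      exact ⟨t, (h t (by omega)).1 h3, rfl, rfl⟩
    · rintro ⟨t, ht, rfl, rfl⟩
      exact ⟨⟨by omega, by omega⟩, rfl, (h t (by omega)).2 ht⟩
  rw [rowLength, this, Finset.card_image_of_injective, Finset.card_range]
  intro s t hst
  simpa using hst

/-- Skew bar tableaux of shape `λ/μ` exist (one may take every bar to be a single square), so that
`srank` below is a minimum over a nonempty set. -/
theorem nonempty_skewBarTableau (lam mu : StrictPartition) (hmu : mu ≤ lam) :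
    Nonempty (SkewBarTableau lam mu) := by
  classical
  let e : ℕ × ℕ → ℕ := fun c =>
    if c ∈ lam.shifted \ mu.shifted then c.1 * lam.part 0 + c.2 + 1 else 0
  have bd : ∀ c ∈ lam.shifted, c.2 < lam.part 0 := by
    intro c hc
    rw [StrictPartition.mem_shifted] at hc
    have := lam.part_add_le c.1 (by omega)
    omega
  have inj : ∀ c ∈ lam.shifted, ∀ d ∈ lam.shifted, 0 < e c → e c = e d → c = d := by
    intro c hc d hd h0 h
    have hc' := bd c hc
    have hd' := bd d hd
    simp only [e] at h0 h
    split_ifs at h0 h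
    · have h1 : c.1 = d.1 := by
        rcases lt_trichotomy c.1 d.1 with h1 | h1 | h1
        · nlinarith [Nat.mul_le_mul_right (lam.part 0) h1]
        · exact h1
        · nlinarith [Nat.mul_le_mul_right (lam.part 0) h1]
      rw [h1] at h
      exact Prod.ext h1 (by omega)
    all_goals omega
  have one : ∀ a, 0 < a → (lam.shifted.filter (fun c => e c = a)).card ≤ 1 := by
    intro a ha
    rw [Finset.card_le_one]
    intro c hc d hd
    rw [Finset.mem_filter] at hc hd
    exact inj c hc.1 d hd.1 (by omega) (by omega)
  have val : ∀ i t, t < lam.part i →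
      e (i, i + t) = if t < mu.part i then 0 else i * lam.part 0 + (i + t) + 1 := by
    intro i t ht
    simp only [e, Finset.mem_sdiff, StrictPartition.mem_shifted]
    split_ifs <;> first | rfl | omega
  have rl : ∀ a i, rowLength lam e a i
      = min (lam.part i) (max (mu.part i) (a - i * lam.part 0 - i)) := by
    intro a i
    refine rowLength_eq lam e a i _ (min_le_left _ _) ?_
    intro t ht
    rw [val i t ht]
    split_ifs <;> omega
  have key : ∀ a i j, i < j → rowLength lam e a i = rowLength lam e a j →
      rowLength lam e a i = 0 := by
    intro a i j hij h
    rw [rl, rl] at h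
    rw [rl]
    by_contra hne
    have hj : lam.part j ≠ 0 := by omega
    have h1 := lam.part_lt hij hj
    have h2 := lam.part_add_le i (by omega)
    have h3 : i * lam.part 0 + lam.part 0 ≤ j * lam.part 0 := by
      have := Nat.mul_le_mul_right (lam.part 0) hij
      rwa [Nat.succ_mul] at this
    have h4 := hmu i
    by_cases hm : mu.part j = 0
    · omega
    · have h5 := mu.part_lt hij hm
      omega
  refine ⟨⟨e, ?_, ?_, ?_, ?_, ?_, ?_, ?_⟩⟩
  · intro c hc
    simp [e, hc]
  · intro i j k hj hk hjk
    simp only [StrictPartition.mem_shifted] at hj hk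
    simp only [e, Finset.mem_sdiff, StrictPartition.mem_shifted]
    split_ifs <;> omega
  · rintro a ha ⟨c, hc, hca⟩
    have h1 := one a ha
    have h2 : 0 < (lam.shifted.filter (fun c => e c = a)).card :=
      Finset.card_pos.2 ⟨c, Finset.mem_filter.2 ⟨hc, hca⟩⟩
    rw [show (lam.shifted.filter (fun c => e c = a)).card = 1 by omega]
    exact odd_one
  · intro a ha
    exact (Finset.card_image_le.trans (one a ha)).trans (by norm_num)
  · intro a ha c hc d hd h1 h2 h3
    exact absurd (congrArg Prod.fst (inj c hc d hd (by omega) (by omega))) h3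
  · intro a i j hij h
    rcases lt_or_gt_of_ne hij with h' | h'
    · exact key a i j h' h
    · rw [h]; exact key a j i h' h.symm
  · refine ⟨1, fun i => ?_⟩
    have := hmu i
    rw [Equiv.Perm.one_apply, rl]
    omega

/-- The number of bars: the number of distinct positive entries. -/
def SkewBarTableau.numBars {lam mu : StrictPartition} (T : SkewBarTableau lam mu) : ℕ :=
  ((lam.shifted.image T.entry).filter (fun a => 0 < a)).card

/-- `srank(λ/μ)`: the number of bars in a skew bar tableau of shape `λ/μ` that has as few bars as
possible. -/
noncomputable def srank (lam mu : StrictPartition) : ℕ :=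
  sInf (Set.range (fun T : SkewBarTableau lam mu => T.numBars))

/-!
The chain of shapes of a strip tableau can be read as a skew bar tableau. Comparing the numbers of
squares on the diagonals shows that removing a strip from `S(λ)` replaces one part of `λ` by a
smaller number that is not a part, and that removing a double strip deletes two parts. If the order
of the parts is forgotten, both operations shorten at most two rows, and two only by emptying
them: they remove one bar. Hence a strip tableau of type `π` with odd parts only yields a skew bar
tableau with at most `ℓ(π)` bars, and every `p_π` with a nonzero coefficient in the definition of
`Q_{λ/μ}` satisfies `srank(λ/μ) ≤ ℓ(π)`. No other expansion has to be considered since the `p_π` are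
linearly independent: a monomial with as many variables as `π` has parts occurs in a `p_ρ` with
`ℓ(ρ) ≤ ℓ(π)` only if its exponents are the parts of `ρ`.
-/

open Finset Function

/-! ### Linear independence of products of power sums -/

section PowerSums

variable {σ : Type*}

/-- The multiset of the nonzero exponents of the monomial `x ^ m`. -/
def exponents (m : σ →₀ ℕ) : Multiset ℕ := m.support.val.map m

theorem card_exponents (m : σ →₀ ℕ) : (exponents m).card = #m.support :=
  Multiset.card_map _ _

theorem exponents_single_add {m : σ →₀ ℕ} {i : σ} (hi : i ∉ m.support) {k : ℕ} (hk : k ≠ 0) :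
    exponents (Finsupp.single i k + m) = k ::ₘ exponents m := by
  rw [exponents, Finsupp.support_single_add hi hk, Finset.cons_val, Multiset.map_cons]
  congr 1
  · simp [Finsupp.notMem_support_iff.1 hi]
  · refine Multiset.map_congr rfl fun j hj => ?_
    have hji : j ≠ i := ne_of_mem_of_not_mem hj hi
    simp [Finsupp.single_eq_of_ne hji]

theorem exists_exponents_eq [Infinite σ] {s : Multiset ℕ} (hs : 0 ∉ s) :
    ∃ m : σ →₀ ℕ, exponents m = s := by
  induction s using Multiset.induction_on with
  | empty => exact ⟨0, by simp [exponents]⟩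
  | cons k s ih =>
    obtain ⟨hk, hs⟩ := not_or.1 (Multiset.mem_cons.not.1 hs)
    obtain ⟨m, rfl⟩ := ih hs
    obtain ⟨i, hi⟩ := Infinite.exists_notMem_finset m.support
    exact ⟨_, exponents_single_add hi (Ne.symm hk)⟩

theorem exists_eq_single_add_of_mem_exponents {m : σ →₀ ℕ} {k : ℕ} (hk : k ∈ exponents m) :
    ∃ i m', m = Finsupp.single i k + m' ∧ exponents m = k ::ₘ exponents m' := by
  obtain ⟨i, hi, rfl⟩ := Multiset.mem_map.1 hk
  have herase : m = Finsupp.single i (m i) + m.erase i := (Finsupp.single_add_erase i m).symm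
  refine ⟨i, m.erase i, herase, ?_⟩
  conv_lhs => rw [herase]
  exact exponents_single_add (by simp) (Finsupp.mem_support_iff.1 hi)

end PowerSums

open Classical in
theorem coeff_powerSum (k : ℕ) (m : ℕ →₀ ℕ) :
    MvPowerSeries.coeff m (powerSum k) = if ∃ i, m = Finsupp.single i k then 1 else 0 := rfl

theorem coeff_powerSum_nonneg (k : ℕ) (m : ℕ →₀ ℕ) :
    0 ≤ MvPowerSeries.coeff m (powerSum k) := by
  rw [coeff_powerSum]
  split_ifs <;> simp

theorem exists_coeff_ne_zero_of_coeff_powerSum_mul_ne_zero {k : ℕ} {f : MvPowerSeries ℕ ℚ}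
    {m : ℕ →₀ ℕ} (h : MvPowerSeries.coeff m (powerSum k * f) ≠ 0) :
    ∃ i m', m = Finsupp.single i k + m' ∧ MvPowerSeries.coeff m' f ≠ 0 := by
  classical
  rw [MvPowerSeries.coeff_mul] at h
  obtain ⟨⟨m₁, m₂⟩, hm, hne⟩ := Finset.exists_ne_zero_of_sum_ne_zero h
  have hm₁ := left_ne_zero_of_mul hne
  rw [coeff_powerSum, ite_ne_right_iff] at hm₁
  obtain ⟨⟨i, rfl⟩, -⟩ := hm₁
  exact ⟨i, m₂, (mem_antidiagonal.1 hm).symm, right_ne_zero_of_mul hne⟩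

theorem coeff_prod_powerSum_nonneg (s : Multiset ℕ) (m : ℕ →₀ ℕ) :
    0 ≤ MvPowerSeries.coeff m (s.map powerSum).prod := by
  classical
  induction s using Multiset.induction_on generalizing m with
  | empty =>
    rw [Multiset.map_zero, Multiset.prod_zero, MvPowerSeries.coeff_one]
    split_ifs <;> simp
  | cons k s ih =>
    rw [Multiset.map_cons, Multiset.prod_cons, MvPowerSeries.coeff_mul]
    exact Finset.sum_nonneg fun x _ => mul_nonneg (coeff_powerSum_nonneg k _) (ih _)

theorem coeff_prod_powerSum_exponents_pos (m : ℕ →₀ ℕ) :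
    0 < MvPowerSeries.coeff m ((exponents m).map powerSum).prod := by
  classical
  induction hs : exponents m using Multiset.induction_on generalizing m with
  | empty =>
    obtain rfl : m = 0 := by simpa [exponents] using hs
    simp
  | cons k s ih =>
    obtain ⟨i, m', hm, hm'⟩ :=
      exists_eq_single_add_of_mem_exponents (hs ▸ Multiset.mem_cons_self k s)
    have hs' : exponents m' = s := (Multiset.cons_inj_right k).1 (hm'.symm.trans hs)
    rw [Multiset.map_cons, Multiset.prod_cons, MvPowerSeries.coeff_mul]
    refine Finset.sum_pos'
      (fun x _ => mul_nonneg (coeff_powerSum_nonneg k _) (coeff_prod_powerSum_nonneg s _))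
      ⟨(Finsupp.single i k, m'), mem_antidiagonal.2 hm.symm, mul_pos ?_ (ih m' hs')⟩
    rw [coeff_powerSum, if_pos ⟨i, rfl⟩]
    exact one_pos

theorem card_support_lt_or_exponents_eq_of_coeff_ne_zero {s : Multiset ℕ} {m : ℕ →₀ ℕ}
    (h : MvPowerSeries.coeff m (s.map powerSum).prod ≠ 0) :
    #m.support < s.card ∨ exponents m = s := by
  classical
  induction s using Multiset.induction_on generalizing m with
  | empty =>
    rw [Multiset.map_zero, Multiset.prod_zero, MvPowerSeries.coeff_one, ite_ne_right_iff] at h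
    exact Or.inr (by simp [h.1, exponents])
  | cons k s ih =>
    rw [Multiset.map_cons, Multiset.prod_cons] at h
    obtain ⟨i, m, rfl, hm⟩ := exists_coeff_ne_zero_of_coeff_powerSum_mul_ne_zero h
    have hsupp : (Finsupp.single i k + m).support ⊆ (Finsupp.single i k).support ∪ m.support :=
      Finsupp.support_add
    rw [Multiset.card_cons]
    rcases ih hm with hlt | rfl
    · have hsingle : #(Finsupp.single i k).support ≤ 1 :=
        (card_le_card Finsupp.support_single_subset).trans_eq (card_singleton i)
      have := (card_le_card hsupp).trans (card_union_le _ _)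
      left
      omega
    · by_cases hnew : i ∉ m.support ∧ k ≠ 0
      · exact Or.inr (exponents_single_add hnew.1 hnew.2)
      · have hsub : (Finsupp.single i k).support ⊆ m.support := by
          rcases not_and_or.1 hnew with hi | hk
          · exact Finsupp.support_single_subset.trans (singleton_subset_iff.2 (not_not.1 hi))
          · simp [not_not.1 hk]
        rw [card_exponents]
        exact Or.inl (Nat.lt_succ_of_le (card_le_card (hsupp.trans (union_subset hsub subset_rfl))))

theorem sigma_partition_eq_of_parts_eq {x y : Σ n : ℕ, n.Partition}
    (h : x.2.parts = y.2.parts) : x = y := by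
  obtain ⟨n, π⟩ := x
  obtain ⟨k, ρ⟩ := y
  obtain rfl : n = k := by rw [← π.parts_sum, ← ρ.parts_sum, h]
  exact congrArg _ (Nat.Partition.ext h)

theorem linearIndependent_powerSumPartition :
    LinearIndependent ℚ (fun x : Σ n : ℕ, n.Partition => powerSumPartition x.2) := by
  rw [linearIndependent_iff]
  intro c hc
  by_contra hne
  obtain ⟨x, hx, hmax⟩ := c.support.exists_max_image (fun x => x.2.parts.card)
    (Finsupp.support_nonempty_iff.2 hne)
  obtain ⟨m, hm⟩ : ∃ m : ℕ →₀ ℕ, exponents m = x.2.parts :=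
    exists_exponents_eq fun h => (x.2.parts_pos h).false
  have hother : ∀ y ∈ c.support, y ≠ x →
      MvPowerSeries.coeff m (c y • powerSumPartition y.2) = 0 := by
    intro y hy hyx
    rw [map_smul, smul_eq_mul]
    refine mul_eq_zero_of_right _ (by_contra fun hcoeff => hyx ?_)
    rcases card_support_lt_or_exponents_eq_of_coeff_ne_zero hcoeff with hlt | heq
    · rw [← card_exponents, hm] at hlt
      exact absurd (hmax y hy) hlt.not_ge
    · exact sigma_partition_eq_of_parts_eq (heq.symm.trans hm)
  have hcoeff : c x * MvPowerSeries.coeff m (powerSumPartition x.2) = 0 := by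
    have h := congrArg (MvPowerSeries.coeff m) hc
    rwa [Finsupp.linearCombination_apply, Finsupp.sum, map_sum, map_zero,
      Finset.sum_eq_single_of_mem x hx hother, map_smul, smul_eq_mul] at h
  have hpos := coeff_prod_powerSum_exponents_pos m
  rw [hm] at hpos
  exact mul_ne_zero (Finsupp.mem_support_iff.1 hx) hpos.ne' hcoeff

theorem IsPowerSumExpansion.unique {f : MvPowerSeries ℕ ℚ} {c c' : (Σ n : ℕ, n.Partition) →₀ ℚ}
    (hc : IsPowerSumExpansion f c) (hc' : IsPowerSumExpansion f c') : c = c' :=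
  linearIndependent_powerSumPartition (hc.symm.trans hc')

/-! ### The parts of a strict partition and the diagonals of its shifted diagram -/

namespace StrictPartition

variable {lam mu nu : StrictPartition}

/-- The set of the (nonzero) parts of a strict partition. -/
def parts (lam : StrictPartition) : Finset ℕ :=
  ((range (lam.part 0)).image lam.part).erase 0

theorem lt_part_zero (lam : StrictPartition) {i : ℕ} (hi : lam.part i ≠ 0) : i < lam.part 0 := by
  have := lam.part_add_le i hi
  omega

theorem mem_parts {d : ℕ} : d ∈ lam.parts ↔ d ≠ 0 ∧ ∃ i, lam.part i = d := by
  simp only [parts, mem_erase, mem_image, mem_range, and_congr_right_iff]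
  refine fun hd => ⟨fun ⟨i, _, hi⟩ => ⟨i, hi⟩, ?_⟩
  rintro ⟨i, rfl⟩
  exact ⟨i, lam.lt_part_zero hd, rfl⟩

theorem zero_notMem_parts (lam : StrictPartition) : 0 ∉ lam.parts :=
  notMem_erase _ _

theorem injOn_part (lam : StrictPartition) : Set.InjOn lam.part (support lam.part) := by
  intro i hi j hj h
  rcases lt_trichotomy i j with hij | hij | hij
  · exact absurd h (lam.part_lt hij hj).ne'
  · exact hij
  · exact absurd h (lam.part_lt hij hi).ne

theorem shifted_subset_shifted (h : mu ≤ lam) : mu.shifted ⊆ lam.shifted := by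
  intro c hc
  rw [mem_shifted] at hc ⊢
  have := h c.1
  omega

theorem mem_diagonal_shifted {d : ℕ} {c : ℕ × ℕ} :
    c ∈ diagonal lam.shifted d ↔ c.2 = c.1 + d ∧ d < lam.part c.1 := by
  rw [diagonal, mem_filter, mem_shifted]
  omega

theorem card_diagonal_shifted (lam : StrictPartition) (d : ℕ) :
    #(diagonal lam.shifted d) = #{x ∈ lam.parts | d < x} := by
  refine card_bij (fun c _ => lam.part c.1) ?_ ?_ ?_
  · intro c hc
    have hd := (mem_diagonal_shifted.1 hc).2
    exact mem_filter.2 ⟨mem_parts.2 ⟨Nat.ne_zero_of_lt hd, c.1, rfl⟩, hd⟩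
  · intro c hc c' hc' h
    obtain ⟨hc, hd⟩ := mem_diagonal_shifted.1 hc
    obtain ⟨hc', hd'⟩ := mem_diagonal_shifted.1 hc'
    have hrow := lam.injOn_part (Nat.ne_zero_of_lt hd) (Nat.ne_zero_of_lt hd') h
    exact Prod.ext hrow (by omega)
  · intro x hx
    obtain ⟨hx, hd⟩ := mem_filter.1 hx
    obtain ⟨-, i, rfl⟩ := mem_parts.1 hx
    exact ⟨(i, i + d), mem_diagonal_shifted.2 ⟨rfl, hd⟩, rfl⟩

theorem card_skewShifted_add (hmu : mu ≤ nu) (hnu : nu ≤ lam) :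
    #(skewShifted lam nu) + #(skewShifted nu mu) = #(skewShifted lam mu) := by
  have hmu := shifted_subset_shifted hmu
  have hnu := shifted_subset_shifted hnu
  rw [skewShifted, skewShifted, skewShifted, card_sdiff_of_subset hmu, card_sdiff_of_subset hnu,
    card_sdiff_of_subset (hmu.trans hnu)]
  have := card_le_card hmu
  have := card_le_card hnu
  omega

theorem card_diagonal_skewShifted_add (h : mu ≤ lam) (d : ℕ) :
    #(diagonal (skewShifted lam mu) d) + #(diagonal mu.shifted d) =
      #(diagonal lam.shifted d) := by
  have hdiff : diagonal (skewShifted lam mu) d =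
      diagonal lam.shifted d \ diagonal mu.shifted d := by
    ext c
    simp only [diagonal, skewShifted, mem_filter, mem_sdiff]
    tauto
  rw [hdiff]
  exact card_sdiff_add_card_eq_card (filter_subset_filter _ (shifted_subset_shifted h))

end StrictPartition

/-! ### Strips occupy an interval of diagonals -/

/-- The index `j - i` of the diagonal of the square `(i, j)`. Subtraction being truncated, this is
meaningful only for squares with `i ≤ j`, such as those of shifted diagrams. -/
def content (c : ℕ × ℕ) : ℕ := c.2 - c.1

theorem RookAdj.content_le_add_one {x y : ℕ × ℕ} (h : RookAdj x y) : content y ≤ content x + 1 := by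
  rw [RookAdj] at h
  rw [content, content]
  omega

theorem exists_reflTransGen_eq_of_le_add_one {α : Type*} {r : α → α → Prop} {f : α → ℕ}
    (hf : ∀ x y, r x y → f y ≤ f x + 1) {a b : α} (hab : Relation.ReflTransGen r a b) {n : ℕ}
    (ha : f a ≤ n) (hb : n ≤ f b) : ∃ c, Relation.ReflTransGen r a c ∧ f c = n := by
  induction hab with
  | refl => exact ⟨a, .refl, le_antisymm ha hb⟩
  | @tail x y hax hxy ih =>
    rcases hb.eq_or_lt with rfl | hlt
    · exact ⟨y, hax.tail hxy, rfl⟩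
    · exact ih (Nat.le_of_lt_succ (hlt.trans_le (hf x y hxy)))

theorem RookConnected.exists_image_content_eq_Ico {D : Finset (ℕ × ℕ)} (hD : RookConnected D) :
    ∃ p q, p < q ∧ D.image content = Ico p q := by
  obtain ⟨a, ha, hmin⟩ := D.exists_min_image content hD.1
  obtain ⟨b, hb, hmax⟩ := D.exists_max_image content hD.1
  refine ⟨content a, content b + 1, Nat.lt_succ_of_le (hmin b hb), ?_⟩
  ext n
  rw [mem_image, mem_Ico, Nat.lt_succ_iff]
  constructor
  · rintro ⟨c, hc, rfl⟩
    exact ⟨hmin c hc, hmax c hc⟩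
  · rintro ⟨han, hnb⟩
    obtain ⟨c, hac, hcn⟩ := exists_reflTransGen_eq_of_le_add_one
      (fun _ _ h => h.2.content_le_add_one) (hD.2 a ha b hb) han hnb
    rcases Relation.ReflTransGen.cases_tail hac with rfl | ⟨_, -, hc, -⟩
    · exact ⟨c, ha, hcn⟩
    · exact ⟨c, hc, hcn⟩

theorem mem_diagonal_skewShifted {lam mu : StrictPartition} {d : ℕ} {c : ℕ × ℕ} :
    c ∈ diagonal (skewShifted lam mu) d ↔ c ∈ skewShifted lam mu ∧ content c = d := by
  rw [diagonal, mem_filter, and_congr_right_iff, content]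
  intro hc
  have := ((lam.mem_shifted c).1 (mem_sdiff.1 hc).1).1
  omega

theorem IsStrip.exists_card_diagonal_eq {lam mu : StrictPartition} (h : IsStrip lam mu) :
    ∃ p q, p < q ∧ q = p + #(skewShifted lam mu) ∧
      ∀ d, #(diagonal (skewShifted lam mu) d) = if d ∈ Ico p q then 1 else 0 := by
  obtain ⟨p, q, hpq, himage⟩ := h.1.exists_image_content_eq_Ico
  have hinj : Set.InjOn content (skewShifted lam mu) := fun c hc c' hc' hcc' =>
    card_le_one.1 (h.2 (content c)) c (mem_diagonal_skewShifted.2 ⟨hc, rfl⟩) c'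
      (mem_diagonal_skewShifted.2 ⟨hc', hcc'.symm⟩)
  have hcard := card_image_of_injOn hinj
  rw [himage, Nat.card_Ico] at hcard
  refine ⟨p, q, hpq, by omega, fun d => ?_⟩
  rw [← himage]
  split_ifs with hd
  · obtain ⟨c, hc, rfl⟩ := mem_image.1 hd
    exact le_antisymm (h.2 _) (card_pos.2 ⟨c, mem_diagonal_skewShifted.2 ⟨hc, rfl⟩⟩)
  · refine card_eq_zero.2 (eq_empty_of_forall_notMem fun c hc => hd ?_)
    obtain ⟨hcD, rfl⟩ := mem_diagonal_skewShifted.1 hc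
    exact mem_image_of_mem content hcD

theorem card_filter_lt_eq_add (A : Finset ℕ) (d : ℕ) :
    #{x ∈ A | d < x} = #{x ∈ A | d + 1 < x} + if d + 1 ∈ A then 1 else 0 := by
  have hsucc : {x ∈ A | d < x} = {x ∈ A | d + 1 < x} ∪ {x ∈ A | x = d + 1} := by
    rw [← filter_or]
    exact filter_congr fun x _ => by omega
  rw [hsucc, card_union_of_disjoint (disjoint_filter.2 fun x _ h h' => by omega), filter_eq']
  split_ifs <;> rfl

theorem eq_insert_erase_of_card_filter_lt {A B : Finset ℕ} (hA : 0 ∉ A) (hB : 0 ∉ B) {p q : ℕ}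
    (hpq : p < q)
    (h : ∀ d, (if d ∈ Ico p q then 1 else 0) + #{x ∈ B | d < x} = #{x ∈ A | d < x}) :
    q ∈ A ∧ p ∉ A ∧ B = (insert p (A.erase q)).erase 0 := by
  have hmem : ∀ d, (if d + 1 ∈ A then 1 else 0) + (if d + 1 = p then 1 else 0) =
      (if d + 1 ∈ B then 1 else 0) + if d + 1 = q then 1 else 0 := by
    intro d
    have hd := h d
    have hd' := h (d + 1)
    rw [card_filter_lt_eq_add A, card_filter_lt_eq_add B] at hd
    simp only [mem_Ico] at hd hd'
    split_ifs at * <;> omega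
  refine ⟨?_, ?_, ?_⟩
  · obtain ⟨d, rfl⟩ := Nat.exists_eq_succ_of_ne_zero (Nat.ne_zero_of_lt hpq)
    grind
  · rcases p with _ | d
    · exact hA
    · grind
  · ext x
    rcases x with _ | d
    · simpa using hB
    · grind

theorem IsStrip.exists_parts_eq {lam mu : StrictPartition} (hle : mu ≤ lam)
    (h : IsStrip lam mu) :
    ∃ p q, q = p + #(skewShifted lam mu) ∧ q ∈ lam.parts ∧ p ∉ lam.parts ∧
      ((diagonal (skewShifted lam mu) 0).Nonempty → p = 0) ∧
      mu.parts = (insert p (lam.parts.erase q)).erase 0 := by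
  obtain ⟨p, q, hpq, hcard, hdiag⟩ := h.exists_card_diagonal_eq
  obtain ⟨hq, hp, hparts⟩ := eq_insert_erase_of_card_filter_lt lam.zero_notMem_parts
    mu.zero_notMem_parts hpq fun d => by
      rw [← hdiag, ← mu.card_diagonal_shifted, ← lam.card_diagonal_shifted,
        StrictPartition.card_diagonal_skewShifted_add hle]
  refine ⟨p, q, hcard, hq, hp, fun h₀ => ?_, hparts⟩
  rw [← card_pos, hdiag] at h₀
  split_ifs at h₀ with hmem
  · exact Nat.le_zero.1 (mem_Ico.1 hmem).1
  · exact absurd h₀ (lt_irrefl 0)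

/-! ### Arrangements of the parts as row lengths, and the removal of bars -/

/-- Apart from zeros, the values of `r` are the elements of `A`, each taken once. Row lengths of
bar tableaux are such arrangements of the parts of a strict partition, not in decreasing order. -/
def IsArrangement {α M : Type*} [Zero M] (r : α → M) (A : Set M) : Prop :=
  Set.BijOn r (support r) A

namespace IsArrangement

variable {α M : Type*} [Zero M] {r r' : α → M} {A : Set M}

theorem zero_notMem (hr : IsArrangement r A) : 0 ∉ A := by
  intro h0
  obtain ⟨i, hi, hi0⟩ := hr.surjOn h0
  exact hi hi0

theorem eq_zero_of_apply_eq (hr : IsArrangement r A) {i j : α} (hij : i ≠ j) (h : r i = r j) :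
    r i = 0 :=
  by_contra fun hi => hij (hr.injOn hi (h ▸ hi : r j ≠ 0) h)

theorem update [DecidableEq α] (hr : IsArrangement r A) {i : α} (hi : r i ≠ 0) {p : M}
    (hp : p ∉ A) : IsArrangement (Function.update r i p) (insert p (A \ {r i}) \ {0}) := by
  have herase : Set.BijOn (Function.update r i p) (support r \ {i}) (A \ {r i}) :=
    (Set.BijOn.sdiff_singleton hr hi).congr fun j hj => (update_of_ne hj.2 p r).symm
  have h0 : (0 : M) ∉ A \ {r i} := fun h => hr.zero_notMem h.1
  rcases eq_or_ne p 0 with rfl | hp0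
  · rwa [IsArrangement, support_update_zero, Set.insert_sdiff_of_mem _ (Set.mem_singleton _),
      Set.sdiff_singleton_eq_self h0]
  · have hsupp : insert i (support r) = insert i (support r \ {i}) := by simp
    have h0' : (0 : M) ∉ insert p (A \ {r i}) := by
      simpa only [Set.mem_insert_iff, not_or] using ⟨hp0.symm, h0⟩
    rw [IsArrangement, support_update_of_ne_zero _ _ hp0, hsupp, Set.sdiff_singleton_eq_self h0']
    have hinsert := herase.insert (a := i) (by rw [update_self]; exact fun h => hp h.1)
    rwa [update_self] at hinsert

theorem exists_perm (hr : IsArrangement r A) (hr' : IsArrangement r' A) (hA : A.Finite) :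
    ∃ s : Equiv.Perm α, ∀ i, r (s i) = r' i := by
  have := hA.to_subtype
  choose f hf hrf using fun a : A => hr.surjOn a.2
  choose g hg hrg using fun a : A => hr'.surjOn a.2
  obtain ⟨s, hs⟩ := Equiv.Perm.exists_extending_pair g f
    (fun a b h => Subtype.ext (by rw [← hrg, h, hrg]))
    (fun a b h => Subtype.ext (by rw [← hrf, h, hrf]))
  refine ⟨s, fun i => ?_⟩
  by_cases hi : r' i = 0
  · by_contra hsi
    rw [hi] at hsi
    let a : A := ⟨r (s i), hr.mapsTo hsi⟩
    have hfa : f a = s i := hr.injOn (hf a) hsi (hrf a)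
    have hga : g a = i := s.injective ((hs a).trans hfa)
    exact hg a (hga.symm ▸ hi)
  · let a : A := ⟨r' i, hr'.mapsTo hi⟩
    have hga : g a = i := hr'.injOn (hg a) hi (hrg a)
    rw [← hga, hs, hrf, hrg]

end IsArrangement

theorem StrictPartition.isArrangement_part (lam : StrictPartition) :
    IsArrangement lam.part (lam.parts : Set ℕ) := by
  refine ⟨fun i hi => mem_parts.2 ⟨hi, i, rfl⟩, lam.injOn_part, fun d hd => ?_⟩
  obtain ⟨hd0, i, rfl⟩ := mem_parts.1 hd
  exact ⟨i, hd0, rfl⟩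

/-- The row lengths `r'` arise from the row lengths `r` by the removal of a bar with an odd number
of squares from the rows in `s`. -/
structure IsBarRemoval {α : Type*} (r r' : α → ℕ) (s : Finset α) : Prop where
  le : r' ≤ r
  eq_of_notMem : ∀ i ∉ s, r' i = r i
  card_le_two : #s ≤ 2
  eq_zero_of_ne : ∀ i ∈ s, ∀ j ∈ s, i ≠ j → r' i = 0
  odd : Odd (∑ i ∈ s, (r i - r' i))

section Update

variable {α : Type*} [DecidableEq α] {r : α → ℕ}

theorem IsStrip.exists_isArrangement_update {lam mu : StrictPartition} (hle : mu ≤ lam)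
    (h : IsStrip lam mu) (hr : IsArrangement r (lam.parts : Set ℕ)) :
    ∃ i p, r i = p + #(skewShifted lam mu) ∧
      ((diagonal (skewShifted lam mu) 0).Nonempty → p = 0) ∧
      IsArrangement (update r i p) (mu.parts : Set ℕ) := by
  obtain ⟨p, q, hq, hqmem, hp, hp0, hparts⟩ := h.exists_parts_eq hle
  obtain ⟨i, hi, rfl⟩ := hr.surjOn hqmem
  refine ⟨i, p, hq, hp0, ?_⟩
  rw [hparts, coe_erase, coe_insert, coe_erase]
  exact hr.update hi hp

theorem isBarRemoval_update {i : α} {p n : ℕ} (hi : r i = p + n) (hn : Odd n) :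
    IsBarRemoval r (update r i p) {i} where
  le := update_le_self_iff.2 (by omega)
  eq_of_notMem j hj := update_of_ne (notMem_singleton.1 hj) p r
  card_le_two := by simp
  eq_zero_of_ne j hj l hl hjl := absurd ((mem_singleton.1 hj).trans (mem_singleton.1 hl).symm) hjl
  odd := by simpa [hi] using hn

theorem isBarRemoval_update_update {i j : α} (hij : i ≠ j) (hodd : Odd (r i + r j)) :
    IsBarRemoval r (update (update r i 0) j 0) {i, j} where
  le l := by
    simp only [update_apply]
    split_ifs <;> omega
  eq_of_notMem l hl := by
    simp only [mem_insert, mem_singleton, not_or] at hl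
    rw [update_of_ne hl.2, update_of_ne hl.1]
  card_le_two := Finset.card_le_two
  eq_zero_of_ne l hl _ _ _ := by
    rcases mem_insert.1 hl with rfl | hl
    · rw [update_of_ne hij, update_self]
    · rw [mem_singleton.1 hl, update_self]
  odd := by simpa [sum_pair hij, update_of_ne hij] using hodd

end Update

theorem IsArrangement.exists_isBarRemoval {α : Type*} {r : α → ℕ} {lam mu : StrictPartition}
    (hr : IsArrangement r (lam.parts : Set ℕ)) (hle : mu ≤ lam)
    (hodd : Odd #(skewShifted lam mu)) (h : IsStrip lam mu ∨ IsDoubleStrip lam mu) :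
    ∃ r', IsArrangement r' (mu.parts : Set ℕ) ∧ ∃ s, IsBarRemoval r r' s := by
  classical
  rcases h with h | ⟨nu, hmu, hnu, hout, hin, hout0, hin0⟩
  · obtain ⟨i, p, hi, -, hr'⟩ := h.exists_isArrangement_update hle hr
    exact ⟨_, hr', _, isBarRemoval_update hi hodd⟩
  · obtain ⟨i, p, hi, hp, hr₁⟩ := hout.exists_isArrangement_update hnu hr
    obtain rfl := hp hout0
    obtain ⟨j, p, hj, hp, hr₂⟩ := hin.exists_isArrangement_update hmu hr₁
    obtain rfl := hp hin0
    have hj0 : Function.update r i 0 j ≠ 0 := by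
      rw [hj, zero_add]
      exact (card_pos.2 hin.1.1).ne'
    have hij : i ≠ j := by
      rintro rfl
      exact hj0 (update_self _ _ _)
    rw [update_of_ne hij.symm] at hj
    refine ⟨_, hr₂, _, isBarRemoval_update_update hij ?_⟩
    rwa [hi, hj, zero_add, zero_add, StrictPartition.card_skewShifted_add hmu hnu]

/-! ### From chains of row lengths to skew bar tableaux -/

theorem content_lt_part {lam : StrictPartition} {c : ℕ × ℕ} (hc : c ∈ lam.shifted) :
    content c < lam.part c.1 := by
  rw [StrictPartition.mem_shifted] at hc
  rw [content]
  omega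

theorem rowLength_add_one (lam : StrictPartition) (entry : ℕ × ℕ → ℕ) (a i : ℕ) :
    rowLength lam entry (a + 1) i =
      rowLength lam entry a i + #{c ∈ lam.shifted | entry c = a + 1 ∧ c.1 = i} := by
  rw [rowLength, rowLength, ← card_union_of_disjoint, ← filter_or]
  · congr 1
    refine filter_congr fun c _ => ?_
    omega
  · refine disjoint_filter.2 fun c _ h h' => ?_
    omega

/-- The row lengths of a skew bar tableau of shape `λ/μ` with entries at most `k`: `row a i` is the
number of squares in row `i` whose entry is at most `a`. -/
structure BarChain (lam mu : StrictPartition) (k : ℕ) where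
  row : ℕ → ℕ → ℕ
  row_of_le : ∀ a, k ≤ a → row a = lam.part
  exists_isBarRemoval : ∀ a < k, ∃ s, IsBarRemoval (row (a + 1)) (row a) s
  eq_zero_of_eq : ∀ a i j, i ≠ j → row a i = row a j → row a i = 0
  isArrangement_zero : IsArrangement (row 0) (mu.parts : Set ℕ)

namespace BarChain

variable {lam mu : StrictPartition} {k : ℕ} (C : BarChain lam mu k)

theorem monotone_row : Monotone C.row := by
  refine monotone_nat_of_le_succ fun a => ?_
  rcases lt_or_ge a k with ha | ha
  · exact (C.exists_isBarRemoval a ha).choose_spec.le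
  · rw [C.row_of_le a ha, C.row_of_le (a + 1) (by omega)]

theorem row_le_part (a i : ℕ) : C.row a i ≤ lam.part i := by
  rw [← C.row_of_le _ (le_max_right a k)]
  exact C.monotone_row (le_max_left a k) i

/-- The filling of `S(λ)` in which the entries at most `a` of row `i` are those of its first
`row a i` squares. -/
noncomputable def filling (c : ℕ × ℕ) : ℕ :=
  if c ∈ lam.shifted then sInf {a | content c < C.row a c.1} else 0

theorem filling_le_iff {c : ℕ × ℕ} (hc : c ∈ lam.shifted) {a : ℕ} :
    C.filling c ≤ a ↔ content c < C.row a c.1 := by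
  have hne : {b | content c < C.row b c.1}.Nonempty :=
    ⟨k, by simpa only [Set.mem_ofPred_eq, C.row_of_le k le_rfl] using content_lt_part hc⟩
  rw [filling, if_pos hc]
  exact ⟨fun h => (Nat.sInf_mem hne).trans_le (C.monotone_row h c.1), fun h => Nat.sInf_le h⟩

theorem filling_le {c : ℕ × ℕ} (hc : c ∈ lam.shifted) : C.filling c ≤ k := by
  rw [C.filling_le_iff hc, C.row_of_le k le_rfl]
  exact content_lt_part hc

theorem filling_eq_add_one_iff {c : ℕ × ℕ} (hc : c ∈ lam.shifted) {a : ℕ} :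
    C.filling c = a + 1 ↔ C.row a c.1 ≤ content c ∧ content c < C.row (a + 1) c.1 := by
  rw [← C.filling_le_iff hc, ← not_lt, ← C.filling_le_iff hc]
  omega

theorem exists_isBarRemoval_of_filling_eq {c : ℕ × ℕ} (hc : c ∈ lam.shifted) {a : ℕ}
    (ha : 0 < a) (hca : C.filling c = a) :
    ∃ b s, a = b + 1 ∧ IsBarRemoval (C.row (b + 1)) (C.row b) s := by
  have := C.filling_le hc
  obtain ⟨b, rfl⟩ := Nat.exists_eq_add_one.2 ha
  obtain ⟨s, hs⟩ := C.exists_isBarRemoval b (by omega)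
  exact ⟨b, s, rfl, hs⟩

theorem fst_mem_of_filling_eq {b : ℕ} {s : Finset ℕ}
    (hs : IsBarRemoval (C.row (b + 1)) (C.row b) s) {c : ℕ × ℕ} (hc : c ∈ lam.shifted)
    (hcb : C.filling c = b + 1) : c.1 ∈ s := by
  by_contra hcs
  have := (C.filling_eq_add_one_iff hc).1 hcb
  have := hs.eq_of_notMem _ hcs
  omega

theorem rowLength_filling (a i : ℕ) : rowLength lam C.filling a i = C.row a i := by
  refine rowLength_eq lam _ a i _ (C.row_le_part a i) fun t ht => ?_
  rw [C.filling_le_iff (by rw [StrictPartition.mem_shifted]; dsimp only; omega), content,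
    Nat.add_sub_cancel_left]

theorem card_filling_eq {b : ℕ} {s : Finset ℕ}
    (hs : IsBarRemoval (C.row (b + 1)) (C.row b) s) :
    #{c ∈ lam.shifted | C.filling c = b + 1} = ∑ i ∈ s, (C.row (b + 1) i - C.row b i) := by
  rw [card_eq_sum_card_fiberwise (f := Prod.fst) (t := s) fun c hc =>
    C.fst_mem_of_filling_eq hs (mem_filter.1 hc).1 (mem_filter.1 hc).2]
  refine sum_congr rfl fun i _ => ?_
  rw [filter_filter, ← C.rowLength_filling, ← C.rowLength_filling, rowLength_add_one,
    Nat.add_sub_cancel_left]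

theorem filling_fst_fst_eq {b : ℕ} {s : Finset ℕ}
    (hs : IsBarRemoval (C.row (b + 1)) (C.row b) s) {c d : ℕ × ℕ} (hc : c ∈ lam.shifted)
    (hd : d ∈ lam.shifted) (hcb : C.filling c = b + 1) (hdb : C.filling d = b + 1)
    (hcd : c.1 ≠ d.1) : C.filling (c.1, c.1) = b + 1 := by
  have hzero := hs.eq_zero_of_ne _ (C.fst_mem_of_filling_eq hs hc hcb) _
    (C.fst_mem_of_filling_eq hs hd hdb) hcd
  have hlt := ((C.filling_eq_add_one_iff hc).1 hcb).2
  have hpart := content_lt_part hc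
  rw [C.filling_eq_add_one_iff (by rw [StrictPartition.mem_shifted]; dsimp only; omega)]
  simp only [content, Nat.sub_self]
  omega

/-- The skew bar tableau with the given row lengths. -/
noncomputable def toSkewBarTableau : SkewBarTableau lam mu where
  entry := C.filling
  entry_off _ hc := if_neg hc
  row_weak i j l hj hl hjl := by
    have := (C.filling_le_iff hl).1 le_rfl
    rw [C.filling_le_iff hj]
    simp only [content] at this ⊢
    omega
  odd_count a ha := by
    rintro ⟨c, hc, hca⟩
    obtain ⟨b, s, rfl, hs⟩ := C.exists_isBarRemoval_of_filling_eq hc ha hca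
    exact C.card_filling_eq hs ▸ hs.odd
  two_rows a ha := by
    rcases (lam.shifted.filter fun c => C.filling c = a).eq_empty_or_nonempty with h | ⟨c, hc⟩
    · simp [h]
    · obtain ⟨hc, hca⟩ := mem_filter.1 hc
      obtain ⟨b, s, rfl, hs⟩ := C.exists_isBarRemoval_of_filling_eq hc ha hca
      refine (card_le_card (image_subset_iff.2 fun d hd => ?_)).trans hs.card_le_two
      exact C.fst_mem_of_filling_eq hs (mem_filter.1 hd).1 (mem_filter.1 hd).2
  begins a ha c hc d hd hca hda hcd := by
    obtain ⟨b, s, rfl, hs⟩ := C.exists_isBarRemoval_of_filling_eq hc ha hca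
    exact ⟨C.filling_fst_fst_eq hs hc hd hca hda hcd,
      C.filling_fst_fst_eq hs hd hc hda hca hcd.symm⟩
  distinct a i j hij h := by
    rw [C.rowLength_filling] at h ⊢
    exact C.eq_zero_of_eq a i j hij (h.trans (C.rowLength_filling a j))
  inner := by
    simp only [C.rowLength_filling]
    exact C.isArrangement_zero.exists_perm mu.isArrangement_part mu.parts.finite_toSet

theorem numBars_toSkewBarTableau_le : C.toSkewBarTableau.numBars ≤ k := by
  have hsub : (lam.shifted.image C.filling).filter (0 < ·) ⊆ Ioc 0 k := by
    intro a ha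
    obtain ⟨ha, hpos⟩ := mem_filter.1 ha
    obtain ⟨c, hc, rfl⟩ := mem_image.1 ha
    exact mem_Ioc.2 ⟨hpos, C.filling_le hc⟩
  exact (card_le_card hsub).trans_eq (Nat.card_Ioc 0 k)

theorem srank_le (C : BarChain lam mu k) : srank lam mu ≤ k :=
  (Nat.sInf_le (Set.mem_range_self C.toSkewBarTableau)).trans C.numBars_toSkewBarTableau_le

end BarChain

/-! ### The degree of the terms of `Q_{λ/μ}` -/

theorem exists_chain_ending_at {α : Type*} {P : ℕ → α → Prop} {R : α → α → Prop} (k : ℕ)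
    (hstep : ∀ a < k, ∀ x, P (a + 1) x → ∃ y, P a y ∧ R x y) (x : α) (hx : P k x) :
    ∃ f : ℕ → α, (∀ a, k ≤ a → f a = x) ∧ (∀ a ≤ k, P a (f a)) ∧
      ∀ a < k, R (f (a + 1)) (f a) := by
  induction k generalizing x with
  | zero => exact ⟨fun _ => x, fun _ _ => rfl, fun a ha => Nat.le_zero.1 ha ▸ hx, by simp⟩
  | succ k ih =>
    obtain ⟨y, hy, hxy⟩ := hstep k k.lt_succ_self x hx
    obtain ⟨f, hf, hP, hR⟩ := ih (fun a ha => hstep a (ha.trans k.lt_succ_self)) y hy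
    refine ⟨fun a => if a ≤ k then f a else x, fun a ha => if_neg (by omega), fun a ha => ?_,
      fun a ha => ?_⟩ <;> dsimp only
    · split_ifs with hak
      · exact hP a hak
      · obtain rfl : a = k + 1 := by omega
        exact hx
    · rw [if_pos (Nat.lt_succ_iff.1 ha)]
      split_ifs with hak
      · exact hR a hak
      · obtain rfl : a = k := by omega
        rwa [hf a le_rfl]

theorem StripTableau.nonempty_barChain {lam mu : StrictPartition} {π : List ℕ}
    (T : StripTableau lam mu π) (hodd : ∀ x ∈ π, Odd x) :
    Nonempty (BarChain lam mu π.length) := by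
  obtain ⟨row, hlast, hrow, hbar⟩ := exists_chain_ending_at
    (P := fun a r => ∀ ha : a < π.length + 1, IsArrangement r ((T.shape ⟨a, ha⟩).parts : Set ℕ))
    (R := fun r r' => ∃ s, IsBarRemoval r r' s) π.length
    (fun a ha r hr => by
      obtain ⟨r', hr', hs⟩ := (hr (Nat.succ_lt_succ ha)).exists_isBarRemoval (T.mono ⟨a, ha⟩)
        (T.size ⟨a, ha⟩ ▸ hodd _ (List.get_mem _ _)) (T.step ⟨a, ha⟩)
      exact ⟨r', fun _ => hr', hs⟩)
    lam.part (fun _ => (congrArg StrictPartition.parts T.last) ▸ lam.isArrangement_part)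
  refine ⟨⟨row, hlast, hbar, fun a i j hij h => ?_, ?_⟩⟩
  · rcases le_total a π.length with ha | ha
    · exact (hrow a ha (Nat.lt_succ_of_le ha)).eq_zero_of_apply_eq hij h
    · rw [hlast a ha] at h ⊢
      exact lam.isArrangement_part.eq_zero_of_apply_eq hij h
  · have h0 := hrow 0 (Nat.zero_le _) (Nat.succ_pos _)
    rwa [show T.shape ⟨0, Nat.succ_pos _⟩ = mu from T.first] at h0

theorem StripTableau.srank_le {lam mu : StrictPartition} {π : List ℕ}
    (T : StripTableau lam mu π) (hodd : ∀ x ∈ π, Odd x) : srank lam mu ≤ π.length :=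
  (T.nonempty_barChain hodd).some.srank_le

/-- The coefficient of `p_π` in the defining sum of `Q_{λ/μ}`. -/
noncomputable def skewQCoeff (lam mu : StrictPartition) {n : ℕ} (π : n.Partition) : ℚ :=
  ∑ᶠ T : StripTableau lam mu (π.parts.sort (· ≥ ·)),
    (2 : ℚ) ^ π.parts.card * T.weight / (zee π : ℚ)

/-- The power sum expansion of `Q_{λ/μ}` given by its definition. -/
noncomputable def skewQExpansion (lam mu : StrictPartition) : (Σ n : ℕ, n.Partition) →₀ ℚ :=
  ∑ π ∈ Nat.Partition.odds #(skewShifted lam mu), Finsupp.single ⟨_, π⟩ (skewQCoeff lam mu π)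

theorem isPowerSumExpansion_iff {f : MvPowerSeries ℕ ℚ} {c : (Σ n : ℕ, n.Partition) →₀ ℚ} :
    IsPowerSumExpansion f c ↔
      f = Finsupp.linearCombination ℚ (fun x => powerSumPartition x.2) c := Iff.rfl

theorem isPowerSumExpansion_skewQ (lam mu : StrictPartition) :
    IsPowerSumExpansion (skewQ lam mu) (skewQExpansion lam mu) := by
  rw [isPowerSumExpansion_iff, skewQExpansion, map_sum, skewQ]
  refine Finset.sum_congr rfl fun π _ => ?_
  rw [Finsupp.linearCombination_single, skewQCoeff, finsum_smul]

theorem srank_le_of_skewQCoeff_ne_zero {lam mu : StrictPartition} {n : ℕ} {π : n.Partition}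
    (hodd : ∀ x ∈ π.parts, Odd x) (h : skewQCoeff lam mu π ≠ 0) :
    srank lam mu ≤ π.parts.card := by
  obtain ⟨T⟩ : Nonempty (StripTableau lam mu (π.parts.sort (· ≥ ·))) :=
    not_isEmpty_iff.1 fun _ => h (finsum_of_isEmpty _)
  rw [← Multiset.length_sort (r := (· ≥ ·))]
  exact T.srank_le fun x hx => hodd x ((Multiset.mem_sort _).1 hx)

theorem srank_le_of_skewQExpansion_ne_zero {lam mu : StrictPartition}
    {x : Σ n : ℕ, n.Partition} (h : skewQExpansion lam mu x ≠ 0) :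
    srank lam mu ≤ x.2.parts.card := by
  classical
  rw [skewQExpansion, Finsupp.finsetSum_apply] at h
  obtain ⟨π, hπ, hne⟩ := Finset.exists_ne_zero_of_sum_ne_zero h
  rw [Finsupp.single_apply, ite_ne_right_iff] at hne
  obtain ⟨rfl, hcoeff⟩ := hne
  exact srank_le_of_skewQCoeff_ne_zero
    (fun y hy => Nat.not_even_iff_odd.1 ((mem_filter.1 hπ).2 y hy)) hcoeff

theorem mainTheorem4 (lam mu : StrictPartition) (hmu : mu ≤ lam) :
    (∃! c : (Σ n : ℕ, n.Partition) →₀ ℚ, IsPowerSumExpansion (skewQ lam mu) c) ∧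
      ∀ c : (Σ n : ℕ, n.Partition) →₀ ℚ, IsPowerSumExpansion (skewQ lam mu) c →
        ∀ (n : ℕ) (pi : n.Partition), c ⟨n, pi⟩ ≠ 0 → srank lam mu ≤ pi.parts.card := by
  have hQ := isPowerSumExpansion_skewQ lam mu
  refine ⟨⟨_, hQ, fun c hc => hc.unique hQ⟩, fun c hc n pi hne => ?_⟩
  rw [hc.unique hQ] at hne
  exact srank_le_of_skewQExpansion_ne_zero hne
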